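/- Let $k$ be a field and let $U$, $A$ be finite-dimensional Hopf algebras over $k$ (coproduct $\Delta$, written $\Delta(a)=a_{(1)}\otimes a_{(2)}$, counit $\epsilon$, antipode $S$) that are dual to each other through a nondegenerate bilinear pairing $\langle\cdot,\cdot\rangle:U\times A\to k$ with $$\langle xy,a\rangle=\langle x,a_{(1)}\rangle\langle y,a_{(2)}\rangle,\quad \langle x,ab\rangle=\langle x_{(1)},a\rangle\langle x_{(2)},b\rangle,\quad \langle 1,a\rangle=\epsilon(a),\quad \langle x,1\rangle=\epsilon(x).$$ Let $\{e_i\}$, $\{f^i\}$ be dual bases of $U$ and $A$, i.e. $\langle e_i,f^j\rangle=\delta_i^j$, and assume that $$\sigma'=\sum_i\langle S^{-2}(e_i),f^i\rangle\neq 0 .$$ Let $U$ be quasitriangular with universal $R$-matrix $\mathcal R=\mathcal R^{(1)}\otimes\mathcal R^{(2)}$; that is, $\mathcal R\in U\otimes U$ is invertible, $\Delta'(x)=\mathcal R\,\Delta(x)\,\mathcal R^{-1}$ for all $x\in U$, where $\Delta'$ is the opposite coproduct, $(\Delta\otimes\mathrm{id})\mathcal R=\mathcal R_{13}\mathcal R_{23}$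 and $(\mathrm{id}\otimes\Delta)\mathcal R=\mathcal R_{13}\mathcal R_{12}$. For $a\in A$ and $x\in U$ put $a\triangleleft x=\langle x,a_{(1)}\rangle a_{(2)}$. Then: 1. The elements $u=S(\mathcal R^{(2)})\mathcal R^{(1)}$ and $s=u\,S(u)\,u^{-2}$ of $U$ are invertible (the invertibility of $u$ gives sense to the definition of $s$), and $$S^4(a)=a\triangleleft s^{-1}\ \text{ for all } a\in A,\qquad S^4(x)=s^{-1}x\ \text{ for all } x\in U.$$ 2. $S^4=\mathrm{id}$, on $U$ and on $A$. 3. For every linear functional $I:A\to k$, written $I(a)=\langle a\rangle$, that is a right invariant integral, i.e. $\langle a_{(1)}\rangle a_{(2)}=\langle a\rangle 1$ for all $a\in A$ (in particular for every biinvariant integral), one has $$\langle ba\rangle=\langle S^2(a)\,b\rangle\quad\text{for all } a,b\in A.$$ -/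

import Mathlib

open scoped TensorProduct

namespace QuantumIntegration

noncomputable section

variable {k U A : Type*} [Field k] [Ring U] [HopfAlgebra k U] [Ring A] [HopfAlgebra k A]

variable (k U A) in
/-- A duality between two Hopf algebras `U` and `A`: a nondegenerate inner product `⟨x, a⟩` that
turns the product and unit of each factor into the coproduct and counit of the other:
`⟨x y, a⟩ = ⟨x, a₍₁₎⟩ ⟨y, a₍₂₎⟩` and `⟨x, a b⟩ = ⟨x₍₁₎, a⟩ ⟨x₍₂₎, b⟩`. -/
structure DualPairing where
  /-- the inner product -/
  pair : U →ₗ[k] A →ₗ[k] k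
  mul_left : ∀ (x y : U) (a : A),
    pair (x * y) a =
      LinearMap.mul' k k (TensorProduct.map (pair x) (pair y) (Coalgebra.comul (R := k) a))
  one_left : ∀ a : A, pair 1 a = Coalgebra.counit (R := k) a
  mul_right : ∀ (x : U) (a b : A),
    pair x (a * b) =
      LinearMap.mul' k k
        (TensorProduct.map (pair.flip a) (pair.flip b) (Coalgebra.comul (R := k) x))
  one_right : ∀ x : U, pair x 1 = Coalgebra.counit (R := k) x
  nondegenerate : pair.Nondegenerate

/-- The right action of `U` on its dual `A`: `a ◁ x = ⟨x, a₍₁₎⟩ a₍₂₎`. -/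
def DualPairing.rightAct (p : DualPairing k U A) (a : A) (x : U) : A :=
  TensorProduct.lid k A ((p.pair x).rTensor A (Coalgebra.comul (R := k) a))

/-- The inverse of the antipode. The antipode of a finite-dimensional Hopf algebra is always
bijective, so there this is a genuine two-sided inverse. -/
def antipodeInv (k U : Type*) [Field k] [Ring U] [HopfAlgebra k U] : Module.End k U :=
  Ring.inverse (HopfAlgebra.antipode k : Module.End k U)

/-- Two (finite) bases `e` of `U` and `f` of `A` are dual: `⟨eᵢ, fʲ⟩ = δᵢʲ`. -/
def DualPairing.IsDualBases (p : DualPairing k U A) {ι : Type*}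
    (e : Module.Basis ι k U) (f : Module.Basis ι k A) : Prop :=
  (∀ i, p.pair (e i) (f i) = 1) ∧ ∀ i j, i ≠ j → p.pair (e i) (f j) = 0

/-- The number `σ' = ∑ᵢ ⟨S⁻²(eᵢ), fⁱ⟩` (for dual bases `e`, `f`). -/
def DualPairing.sigma' (p : DualPairing k U A) {ι : Type*} [Fintype ι]
    (e : Module.Basis ι k U) (f : Module.Basis ι k A) : k :=
  ∑ i, p.pair ((antipodeInv k U ^ 2) (e i)) (f i)

/-- `R₁₂ = R⁽¹⁾ ⊗ R⁽²⁾ ⊗ 1` in `U ⊗ U ⊗ U`. -/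
def leg12 : U ⊗[k] U →ₐ[k] U ⊗[k] (U ⊗[k] U) :=
  Algebra.TensorProduct.map (AlgHom.id k U) Algebra.TensorProduct.includeLeft

/-- `R₁₃ = R⁽¹⁾ ⊗ 1 ⊗ R⁽²⁾` in `U ⊗ U ⊗ U`. -/
def leg13 : U ⊗[k] U →ₐ[k] U ⊗[k] (U ⊗[k] U) :=
  Algebra.TensorProduct.map (AlgHom.id k U) Algebra.TensorProduct.includeRight

/-- `R₂₃ = 1 ⊗ R⁽¹⁾ ⊗ R⁽²⁾` in `U ⊗ U ⊗ U`. -/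
def leg23 : U ⊗[k] U →ₐ[k] U ⊗[k] (U ⊗[k] U) :=
  Algebra.TensorProduct.includeRight

/-- `R` is a universal R-matrix for `U`, i.e. `(U, R)` is a quasitriangular Hopf algebra. -/
structure IsUniversalRMatrix (R : (U ⊗[k] U)ˣ) : Prop where
  /-- `Δ'(x) = R Δ(x) R⁻¹` with `Δ'` the opposite coproduct -/
  comul_op : ∀ x : U,
    TensorProduct.comm k U U (Coalgebra.comul (R := k) x) =
      (R : U ⊗[k] U) * Coalgebra.comul (R := k) x * ((R⁻¹ : (U ⊗[k] U)ˣ) : U ⊗[k] U)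
  /-- `(Δ ⊗ id) R = R₁₃ R₂₃` -/
  comul_left :
    TensorProduct.assoc k U U U
        ((Coalgebra.comul (R := k) (A := U)).rTensor U (R : U ⊗[k] U)) =
      leg13 (R : U ⊗[k] U) * leg23 (R : U ⊗[k] U)
  /-- `(id ⊗ Δ) R = R₁₃ R₁₂` -/
  comul_right :
    (Coalgebra.comul (R := k) (A := U)).lTensor U (R : U ⊗[k] U) =
      leg13 (R : U ⊗[k] U) * leg12 (R : U ⊗[k] U)

/-- The element `S(R⁽²⁾) R⁽¹⁾` of `U`, for `R = R⁽¹⁾ ⊗ R⁽²⁾`. -/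
def drinfeldElement (R : U ⊗[k] U) : U :=
  LinearMap.mul' k U ((HopfAlgebra.antipode k (A := U)).rTensor U (TensorProduct.comm k U U R))

/-- A right invariant integral on `A`: a linear functional with
`⟨a₍₁₎⟩ a₍₂₎ = ⟨a⟩ 1` for all `a`. -/
def IsRightIntegral (I : A →ₗ[k] k) : Prop :=
  ∀ a : A, TensorProduct.lid k A (I.rTensor A (Coalgebra.comul (R := k) a)) = I a • (1 : A)

end

end QuantumIntegration

/-!
The functional `x ↦ Tr(z ↦ x S⁻²(z))` on `U` takes the value `σ' ≠ 0` at `1`, and the element `t` of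
`A` that represents it is a right integral: the twist by `S⁻²` lets the trace be cycled. Since
`ε(t) = σ' ≠ 0`, the two evaluations of `t S(t)` give `S(t) = t`, so `t` is two-sided. The same
construction with the roles of `U` and `A` exchanged gives `y` in `U`, and `⟨y, t⟩ = σ' ≠ 0`.

Put `I = ⟨y, ·⟩`. Integrality of `t` moves factors from one leg of `Δ(t)` to the other at the cost
of an antipode, and slicing with `I` turns this into `I(ba) = I(S²(a) b)`. Applied twice, this gives
`I(ba) = I(S⁴(b) a)`, whence `S⁴ = id` because `I` is faithful. Similarly, applying `⟨·, t⟩` to one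
leg of `Δ'(y) R = R Δ(y)` gives `S(u) = u`, that is, `s = 1`.
-/

namespace QuantumIntegration

noncomputable section

open Coalgebra HopfAlgebra LinearMap TensorProduct WithConv

lemma sum_counit_right_smul_left {k C κ : Type*} [CommSemiring k] [AddCommMonoid C] [Module k C]
    [Coalgebra k C] {c : C} (r : Repr k c κ) :
    ∑ i ∈ r.index, counit (R := k) (r.right i) • r.left i = c := by
  have := congr(TensorProduct.rid k C $(sum_tmul_counit_eq (R := k) r))
  simpa only [map_sum, TensorProduct.rid_tmul, one_smul] using this

section Slice

variable {k H : Type*} [CommSemiring k] [Semiring H] [Algebra k H]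

/-- The slice map `a ⊗ b ↦ I(a) b`. -/
def sliceLeft (I : H →ₗ[k] k) : H ⊗[k] H →ₗ[k] H :=
  (TensorProduct.lid k H).toLinearMap ∘ₗ I.rTensor H

/-- The slice map `a ⊗ b ↦ I(b) a`. -/
def sliceRight (I : H →ₗ[k] k) : H ⊗[k] H →ₗ[k] H :=
  (TensorProduct.rid k H).toLinearMap ∘ₗ I.lTensor H

variable (I : H →ₗ[k] k)

@[simp] lemma sliceLeft_tmul (a b : H) : sliceLeft I (a ⊗ₜ b) = I a • b := rfl

@[simp] lemma sliceRight_tmul (a b : H) : sliceRight I (a ⊗ₜ b) = I b • a := rfl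

lemma sliceRight_comm (X : H ⊗[k] H) :
    sliceRight I (TensorProduct.comm k H H X) = sliceLeft I X := by
  induction X with
  | zero => simp only [map_zero]
  | add X Y hX hY => simp only [map_add, hX, hY]
  | tmul a b => rfl

lemma apply_sliceRight (X : H ⊗[k] H) : I (sliceRight I X) = I (sliceLeft I X) := by
  induction X with
  | zero => simp only [map_zero]
  | add X Y hX hY => simp only [map_add, hX, hY]
  | tmul a b => simp [mul_comm]

lemma sliceLeft_one_tmul_mul_mul (c d : H) (X : H ⊗[k] H) :
    sliceLeft I ((1 ⊗ₜ c) * X * (1 ⊗ₜ d)) = c * sliceLeft I X * d := by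
  induction X with
  | zero => simp only [mul_zero, zero_mul, map_zero]
  | add X Y hX hY => simp only [mul_add, add_mul, map_add, hX, hY]
  | tmul a b => simp

lemma sliceLeft_mul_one_tmul (d : H) (X : H ⊗[k] H) :
    sliceLeft I (X * (1 ⊗ₜ d)) = sliceLeft I X * d := by
  simpa [← Algebra.TensorProduct.one_def] using sliceLeft_one_tmul_mul_mul I 1 d X

lemma sliceRight_tmul_one_mul_mul (c d : H) (X : H ⊗[k] H) :
    sliceRight I ((c ⊗ₜ 1) * X * (d ⊗ₜ 1)) = c * sliceRight I X * d := by
  induction X with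
  | zero => simp only [mul_zero, zero_mul, map_zero]
  | add X Y hX hY => simp only [mul_add, add_mul, map_add, hX, hY]
  | tmul a b => simp

lemma sliceRight_tmul_one_mul (c : H) (X : H ⊗[k] H) :
    sliceRight I ((c ⊗ₜ 1) * X) = c * sliceRight I X := by
  simpa [← Algebra.TensorProduct.one_def] using sliceRight_tmul_one_mul_mul I c 1 X

end Slice

section Bialgebra

variable {k H : Type*} [CommSemiring k] [Semiring H] [Bialgebra k H]

lemma includeLeft_convMul_includeRight :
    toConv (Algebra.TensorProduct.includeLeft : H →ₐ[k] H ⊗[k] H).toLinearMap *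
      toConv (Algebra.TensorProduct.includeRight : H →ₐ[k] H ⊗[k] H).toLinearMap =
        toConv comul := by
  ext x
  simp [(ℛ k x).convMul_apply, (ℛ k x).eq]

variable (k) in
/-- A left integral in `H`, as opposed to a left invariant functional on `H`:
an element `t` with `h t = ε(h) t` for all `h`. -/
def IsLeftIntegralElem (t : H) : Prop := ∀ h : H, h * t = counit (R := k) h • t

variable (k) in
/-- A right integral in `H`, as opposed to a right invariant functional on `H`:
an element `t` with `t h = ε(h) t` for all `h`. -/
def IsRightIntegralElem (t : H) : Prop := ∀ h : H, t * h = counit (R := k) h • t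

/-- A left invariant integral on `H`: a linear functional with `a₍₁₎ ⟨a₍₂₎⟩ = ⟨a⟩ 1` for all `a`. -/
def IsLeftIntegral (I : H →ₗ[k] k) : Prop := ∀ a : H, sliceRight I (comul a) = I a • (1 : H)

end Bialgebra

section Hopf

variable {k H : Type*} [CommSemiring k] [Semiring H] [HopfAlgebra k H]

section AlgHom

variable {B : Type*} [Semiring B] [Algebra k B] (f : H →ₐ[k] B)

lemma algHom_comp_antipode_convMul :
    toConv (f.toLinearMap ∘ₗ antipode k) * toConv f.toLinearMap = 1 := by
  have h := algHom_comp_convMul_distrib f (toConv (antipode k)) (toConv .id)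
  rw [antipode_mul_id] at h
  refine (WithConv.ofConv_injective h).symm.trans ?_
  ext x
  simp

lemma algHom_convMul_comp_antipode :
    toConv f.toLinearMap * toConv (f.toLinearMap ∘ₗ antipode k) = 1 := by
  have h := algHom_comp_convMul_distrib f (toConv .id) (toConv (antipode k))
  rw [id_mul_antipode] at h
  refine (WithConv.ofConv_injective h).symm.trans ?_
  ext x
  simp

end AlgHom

lemma sum_antipode_tmul_one_mul_comul {κ : Type*} {h : H} (r : Repr k h κ) :
    ∑ i ∈ r.index, (antipode k (r.left i) ⊗ₜ[k] (1 : H)) * comul (R := k) (r.right i) =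
      1 ⊗ₜ[k] h := by
  let i₁ : H →ₐ[k] H ⊗[k] H := Algebra.TensorProduct.includeLeft
  have key : toConv (i₁.toLinearMap ∘ₗ antipode k) * toConv comul =
      toConv (Algebra.TensorProduct.includeRight : H →ₐ[k] H ⊗[k] H).toLinearMap := by
    rw [← includeLeft_convMul_includeRight, ← mul_assoc, algHom_comp_antipode_convMul, one_mul]
  simpa [i₁, r.convMul_apply] using congr($key h)

lemma sum_comul_mul_one_tmul_antipode {κ : Type*} {h : H} (r : Repr k h κ) :
    ∑ i ∈ r.index, comul (R := k) (r.left i) * ((1 : H) ⊗ₜ[k] antipode k (r.right i)) =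
      h ⊗ₜ[k] 1 := by
  let i₂ : H →ₐ[k] H ⊗[k] H := Algebra.TensorProduct.includeRight
  have key : toConv comul * toConv (i₂.toLinearMap ∘ₗ antipode k) =
      toConv (Algebra.TensorProduct.includeLeft : H →ₐ[k] H ⊗[k] H).toLinearMap := by
    rw [← includeLeft_convMul_includeRight, mul_assoc, algHom_convMul_comp_antipode, mul_one]
  simpa [i₂, r.convMul_apply] using congr($key h)

lemma IsLeftIntegralElem.one_tmul_mul_comul {t : H} (ht : IsLeftIntegralElem k t) (h : H) :
    (1 ⊗ₜ[k] h) * comul (R := k) t = (antipode k h ⊗ₜ[k] 1) * comul t := by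
  let r := ℛ k h
  calc (1 ⊗ₜ[k] h) * comul (R := k) t
      = ∑ i ∈ r.index, (antipode k (r.left i) ⊗ₜ[k] 1) * comul (r.right i * t) := by
        simp only [← sum_antipode_tmul_one_mul_comul r, Finset.sum_mul, mul_assoc,
          Bialgebra.comul_mul]
    _ = (antipode k (∑ i ∈ r.index, counit (R := k) (r.right i) • r.left i) ⊗ₜ[k] 1) *
          comul t := by
        simp only [ht _, map_smul, map_sum, TensorProduct.sum_tmul, Finset.sum_mul,
          ← TensorProduct.smul_tmul', smul_mul_assoc, mul_smul_comm]
    _ = (antipode k h ⊗ₜ[k] 1) * comul t := by rw [sum_counit_right_smul_left]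

lemma IsRightIntegralElem.comul_mul_tmul_one {t : H} (ht : IsRightIntegralElem k t) (h : H) :
    comul (R := k) t * (h ⊗ₜ[k] 1) = comul t * (1 ⊗ₜ[k] antipode k h) := by
  let r := ℛ k h
  calc comul (R := k) t * (h ⊗ₜ[k] 1)
      = ∑ i ∈ r.index, comul (t * r.left i) * (1 ⊗ₜ[k] antipode k (r.right i)) := by
        simp only [← sum_comul_mul_one_tmul_antipode r, Finset.mul_sum, ← mul_assoc,
          Bialgebra.comul_mul]
    _ = comul t * (1 ⊗ₜ[k] antipode k (∑ i ∈ r.index, counit (R := k) (r.left i) • r.right i)) := by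
        simp only [ht _, map_smul, map_sum, TensorProduct.tmul_sum, Finset.mul_sum,
          TensorProduct.tmul_smul, smul_mul_assoc, mul_smul_comm]
    _ = comul t * (1 ⊗ₜ[k] antipode k h) := by rw [sum_counit_smul]

end Hopf

section Integral

variable {k H : Type*} [Field k] [Ring H] [HopfAlgebra k H]

section Elem

variable {t : H} (ht : IsRightIntegralElem k t) (hε : counit (R := k) t ≠ 0)
  (hS : Function.Surjective (antipode k (A := H)))
include ht hε hS

lemma IsRightIntegralElem.antipode_eq_self : antipode k t = t := by
  have h_left : IsLeftIntegralElem k (antipode k t) := fun h => by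
    obtain ⟨g, rfl⟩ := hS h
    rw [← antipode_mul_antidistrib, ht, map_smul, counit_antipode]
  have h := ht (antipode k t)
  rw [h_left, counit_antipode] at h
  exact smul_right_injective _ hε h

lemma IsRightIntegralElem.isLeftIntegralElem : IsLeftIntegralElem k t := fun h => by
  obtain ⟨g, rfl⟩ := hS h
  rw [← ht.antipode_eq_self hε hS, ← antipode_mul_antidistrib, ht, map_smul, counit_antipode]

end Elem

variable (k) in
/-- A two-sided integral fixed by the antipode and with nonzero counit. By Maschke's theorem such
an element exists only when `H` is semisimple. -/
structure IsSemisimpleIntegral (t : H) : Prop where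
  left : IsLeftIntegralElem k t
  right : IsRightIntegralElem k t
  antipode_eq_self : antipode k t = t
  counit_ne_zero : counit (R := k) t ≠ 0

lemma IsRightIntegralElem.isSemisimpleIntegral {t : H} (ht : IsRightIntegralElem k t)
    (hε : counit (R := k) t ≠ 0) (hS : Function.Surjective (antipode k (A := H))) :
    IsSemisimpleIntegral k t :=
  ⟨ht.isLeftIntegralElem hε hS, ht, ht.antipode_eq_self hε hS, hε⟩

lemma IsRightIntegral.sliceLeft_comul {I : H →ₗ[k] k} (hI : IsRightIntegral I) (a : H) :
    sliceLeft I (comul a) = I a • (1 : H) := hI a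

lemma IsRightIntegral.apply_mul_apply_one {I J : H →ₗ[k] k} (hI : IsRightIntegral I)
    (hJ : IsLeftIntegral J) (a : H) : I a * J 1 = J a * I 1 := by
  -- Both sides are `I(a₍₁₎) J(a₍₂₎)`.
  have h_slice : ∀ X : H ⊗[k] H, J (sliceLeft I X) = I (sliceRight J X) := fun X => by
    induction X with
    | zero => simp only [map_zero]
    | add X Y hX hY => simp only [map_add, hX, hY]
    | tmul a b => simp [mul_comm]
  have h := h_slice (comul a)
  rw [hJ a, hI.sliceLeft_comul] at h
  simpa only [map_smul, smul_eq_mul] using h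

section Pair

variable {I : H →ₗ[k] k} {t : H}

lemma eq_zero_of_forall_apply_mul_eq_zero (hI : IsLeftIntegral I) (ht : IsLeftIntegralElem k t)
    (hIt : I t ≠ 0) (hS : Function.Injective (antipode k (A := H))) {c : H}
    (hc : ∀ a, I (c * a) = 0) : c = 0 := by
  have h_slice : ∀ X : H ⊗[k] H, sliceRight I ((1 ⊗ₜ c) * X) = 0 := fun X => by
    induction X with
    | zero => simp only [mul_zero, map_zero]
    | add X Y hX hY => simp only [mul_add, map_add, hX, hY, add_zero]
    | tmul a b => simp [hc]
  have h := h_slice (comul t)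
  rw [ht.one_tmul_mul_comul, sliceRight_tmul_one_mul, hI t, mul_smul_comm, mul_one] at h
  exact (map_eq_zero_iff _ hS).mp ((smul_eq_zero_iff_right hIt).mp h)

variable (hI : IsLeftIntegral I) (hI' : IsRightIntegral I) (hIS : ∀ a, I (antipode k a) = I a)
  (ht : IsLeftIntegralElem k t) (ht' : IsRightIntegralElem k t) (hIt : I t ≠ 0)
include hI hI' hIS ht ht' hIt

lemma apply_mul_eq_apply_antipode_sq_mul (a b : H) :
    I (b * a) = I (antipode k (antipode k a) * b) := by
  refine (mul_left_cancel₀ hIt ?_).symm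
  calc I t * I (antipode k (antipode k a) * b)
      = I (sliceRight I ((antipode k (antipode k a) ⊗ₜ 1) * comul t * (b ⊗ₜ 1))) := by
        simp [sliceRight_tmul_one_mul_mul, hI t]
    _ = I (sliceLeft I ((1 ⊗ₜ antipode k a) * comul t * (1 ⊗ₜ antipode k b))) := by
        rw [← ht.one_tmul_mul_comul, mul_assoc, ht'.comul_mul_tmul_one, ← mul_assoc,
          apply_sliceRight]
    _ = I t * I (antipode k a * antipode k b) := by
        rw [sliceLeft_one_tmul_mul_mul, hI'.sliceLeft_comul]
        simp
    _ = I t * I (b * a) := by rw [← antipode_mul_antidistrib, hIS]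

theorem antipode_pow_four_eq_one (hS : Function.Injective (antipode k (A := H))) :
    (antipode k : Module.End k H) ^ 4 = 1 := by
  have h_swap := apply_mul_eq_apply_antipode_sq_mul hI hI' hIS ht ht' hIt
  have h_invol (a b : H) : I (b * a) = I (((antipode k : Module.End k H) ^ 4) b * a) :=
    calc I (b * a)
        = I (antipode k a * antipode k b) := by rw [← antipode_mul_antidistrib, hIS]
      _ = I (antipode k (a * antipode k (antipode k b))) := by
          rw [h_swap, ← antipode_mul_antidistrib]
      _ = I (((antipode k : Module.End k H) ^ 4) b * a) := by rw [hIS, h_swap]; rfl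
  ext b
  refine sub_eq_zero.mp (eq_zero_of_forall_apply_mul_eq_zero hI ht hIt hS fun a => ?_)
  rw [Module.End.one_apply, sub_mul, map_sub, ← h_invol, sub_self]

end Pair

end Integral

section RMatrix

section Contract

variable {k U B : Type*} [CommSemiring k] [Semiring U] [Bialgebra k U] [Semiring B] [Algebra k B]

/-- The contraction `a ⊗ b ⊗ c ↦ φ(a) ψ(b) ⊗ c`. -/
def mulFirstTwo (φ ψ : U →ₗ[k] B) : U ⊗[k] (U ⊗[k] U) →ₗ[k] B ⊗[k] U :=
  (mul' k B ∘ₗ TensorProduct.map φ ψ).rTensor U ∘ₗ (TensorProduct.assoc k U U U).symm.toLinearMap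

/-- The contraction `a ⊗ b ⊗ c ↦ a ⊗ φ(b) ψ(c)`. -/
def mulLastTwo (φ ψ : U →ₗ[k] B) : U ⊗[k] (U ⊗[k] U) →ₗ[k] U ⊗[k] B :=
  (mul' k B ∘ₗ TensorProduct.map φ ψ).lTensor U

variable (φ ψ : U →ₗ[k] B) (X : U ⊗[k] U)

lemma mulFirstTwo_comul_rTensor :
    mulFirstTwo φ ψ (TensorProduct.assoc k U U U ((comul (R := k) (A := U)).rTensor U X)) =
      (toConv φ * toConv ψ).ofConv.rTensor U X := by
  simp [mulFirstTwo, LinearMap.convMul_def, ← rTensor_comp_apply, comp_assoc]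

lemma mulLastTwo_comul_lTensor :
    mulLastTwo φ ψ ((comul (R := k) (A := U)).lTensor U X) =
      (toConv φ * toConv ψ).ofConv.lTensor U X := by
  simp [mulLastTwo, LinearMap.convMul_def, ← lTensor_comp_apply, comp_assoc]

end Contract

section Leg

variable {k U B : Type*} [Field k] [Ring U] [HopfAlgebra k U] [Semiring B] [Algebra k B]
  (φ ψ : U →ₗ[k] B) (X Y : U ⊗[k] U)

lemma mulFirstTwo_leg13_mul_leg23 :
    mulFirstTwo φ ψ (leg13 X * leg23 Y) = φ.rTensor U X * ψ.rTensor U Y := by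
  induction X with
  | zero => simp only [map_zero, zero_mul]
  | add X₁ X₂ h₁ h₂ => simp only [map_add, add_mul, h₁, h₂]
  | tmul a b =>
    induction Y with
    | zero => simp only [map_zero, mul_zero]
    | add Y₁ Y₂ h₁ h₂ => simp only [map_add, mul_add, h₁, h₂]
    | tmul c d => simp [mulFirstTwo, leg13, leg23]

lemma mulLastTwo_leg12_mul_leg13 :
    mulLastTwo φ ψ (leg12 X * leg13 Y) = φ.lTensor U X * ψ.lTensor U Y := by
  induction X with
  | zero => simp only [map_zero, zero_mul]
  | add X₁ X₂ h₁ h₂ => simp only [map_add, add_mul, h₁, h₂]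
  | tmul a b =>
    induction Y with
    | zero => simp only [map_zero, mul_zero]
    | add Y₁ Y₂ h₁ h₂ => simp only [map_add, mul_add, h₁, h₂]
    | tmul c d => simp [mulLastTwo, leg12, leg13]

end Leg

section Sandwich

variable {k U : Type*} [CommSemiring k] [Semiring U] [Algebra k U]

/-- The map `a ⊗ b ↦ b w a`. -/
def sandwich (w : U) : U ⊗[k] U →ₗ[k] U :=
  mul' k U ∘ₗ (mulRight k w).rTensor U ∘ₗ (TensorProduct.comm k U U).toLinearMap

@[simp] lemma sandwich_tmul (w a b : U) : sandwich (k := k) w (a ⊗ₜ b) = b * w * a := rfl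

end Sandwich

section DrinfeldMap

variable {k U : Type*} [Field k] [Ring U] [HopfAlgebra k U]

/-- The map `a ⊗ b ↦ S(b) a`, whose value at `R` is the Drinfeld element. -/
def drinfeldMap : U ⊗[k] U →ₗ[k] U :=
  mul' k U ∘ₗ (antipode k (A := U)).rTensor U ∘ₗ (TensorProduct.comm k U U).toLinearMap

lemma drinfeldMap_apply (X : U ⊗[k] U) : drinfeldMap X = drinfeldElement X := rfl

@[simp] lemma drinfeldMap_tmul (a b : U) : drinfeldMap (k := k) (a ⊗ₜ b) = antipode k b * a := rfl

lemma drinfeldMap_mul_tmul (X : U ⊗[k] U) (a b : U) :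
    drinfeldMap (X * a ⊗ₜ[k] b) = antipode k b * drinfeldMap X * a := by
  induction X with
  | zero => simp only [map_zero, mul_zero, zero_mul]
  | add X Y hX hY => simp only [map_add, add_mul, mul_add, hX, hY]
  | tmul c d => simp [antipode_mul_antidistrib, mul_assoc]

lemma drinfeldMap_mul (X Y : U ⊗[k] U) :
    drinfeldMap (X * Y) = sandwich (drinfeldMap X) ((antipode k).lTensor U Y) := by
  induction Y with
  | zero => simp only [map_zero, mul_zero]
  | add Y Z hY hZ => simp only [map_add, mul_add, hY, hZ]
  | tmul a b => simp [drinfeldMap_mul_tmul]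

lemma drinfeldMap_comm_comul_mul (x : U) (X : U ⊗[k] U) :
    drinfeldMap (TensorProduct.comm k U U (comul x) * X) = counit (R := k) x • drinfeldMap X := by
  induction X with
  | zero => simp only [map_zero, mul_zero, smul_zero]
  | add X Y hX hY => simp only [map_add, mul_add, smul_add, hX, hY]
  | tmul c d =>
    rw [drinfeldMap_mul_tmul, ← (ℛ k x).eq]
    simp [sum_antipode_mul_eq_smul]

lemma antipode_drinfeldMap (X : U ⊗[k] U) :
    antipode k (drinfeldMap X) =
      mul' k U ((antipode k).lTensor U (TensorProduct.map (antipode k) (antipode k) X)) := by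
  induction X with
  | zero => simp only [map_zero]
  | add X Y hX hY => simp only [map_add, hX, hY]
  | tmul a b => simp [antipode_mul_antidistrib]

lemma IsRightIntegralElem.sliceLeft_comul_mul_comm {t : U} (ht : IsRightIntegralElem k t)
    (I : U →ₗ[k] k) (X : U ⊗[k] U) :
    sliceLeft I (comul t * TensorProduct.comm k U U X) =
      sliceLeft I (comul t) * drinfeldMap X := by
  induction X with
  | zero => simp only [map_zero, mul_zero]
  | add X Y hX hY => simp only [map_add, mul_add, hX, hY]
  | tmul a b =>
    calc sliceLeft I (comul t * b ⊗ₜ a)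
        = sliceLeft I (comul t * (b ⊗ₜ 1) * (1 ⊗ₜ a)) := by simp [mul_assoc]
      _ = sliceLeft I (comul t * (1 ⊗ₜ (antipode k b * a))) := by
          rw [ht.comul_mul_tmul_one]; simp [mul_assoc]
      _ = sliceLeft I (comul t) * (antipode k b * a) := sliceLeft_mul_one_tmul I _ _

lemma IsLeftIntegralElem.sliceRight_mul_comul {t : U} (ht : IsLeftIntegralElem k t)
    (I : U →ₗ[k] k) (X : U ⊗[k] U) :
    sliceRight I (X * comul t) =
      mul' k U ((antipode k).lTensor U X) * sliceRight I (comul t) := by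
  induction X with
  | zero => simp only [map_zero, zero_mul]
  | add X Y hX hY => simp only [map_add, add_mul, hX, hY]
  | tmul a b =>
    calc sliceRight I (a ⊗ₜ b * comul t)
        = sliceRight I ((a ⊗ₜ 1) * ((1 ⊗ₜ b) * comul t)) := by simp [← mul_assoc]
      _ = sliceRight I (((a * antipode k b) ⊗ₜ 1) * comul t) := by
          rw [ht.one_tmul_mul_comul]; simp [← mul_assoc]
      _ = a * antipode k b * sliceRight I (comul t) := sliceRight_tmul_one_mul I _ _

end DrinfeldMap

namespace IsUniversalRMatrix

variable {k U : Type*} [Field k] [Ring U] [HopfAlgebra k U] {R : (U ⊗[k] U)ˣ}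
  (hR : IsUniversalRMatrix R)
include hR

lemma comm_comul_mul (x : U) :
    TensorProduct.comm k U U (comul (R := k) x) * R = R * comul (R := k) x := by
  rw [hR.comul_op, mul_assoc, Units.inv_mul, mul_one]

lemma comul_right_inv :
    (comul (R := k) (A := U)).lTensor U (↑R⁻¹ : U ⊗[k] U) =
      leg12 (↑R⁻¹ : U ⊗[k] U) * leg13 (↑R⁻¹ : U ⊗[k] U) := by
  let Δ₂ : U ⊗[k] U →ₐ[k] U ⊗[k] (U ⊗[k] U) :=
    Algebra.TensorProduct.map (AlgHom.id k U) (Bialgebra.comulAlgHom k U)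
  have h : Units.map Δ₂.toMonoidHom R =
      Units.map leg13.toMonoidHom R * Units.map leg12.toMonoidHom R := Units.ext hR.comul_right
  have h_inv := congrArg (·⁻¹) h
  simp only [mul_inv_rev, ← map_inv] at h_inv
  exact congrArg Units.val h_inv

section Conv

variable {B : Type*} [Semiring B] [Algebra k B] (φ ψ : U →ₗ[k] B)

lemma rTensor_convMul :
    (toConv φ * toConv ψ).ofConv.rTensor U (R : U ⊗[k] U) =
      φ.rTensor U (R : U ⊗[k] U) * ψ.rTensor U (R : U ⊗[k] U) := by
  rw [← mulFirstTwo_comul_rTensor, hR.comul_left, mulFirstTwo_leg13_mul_leg23]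

lemma lTensor_inv_convMul :
    (toConv φ * toConv ψ).ofConv.lTensor U (↑R⁻¹ : U ⊗[k] U) =
      φ.lTensor U (↑R⁻¹ : U ⊗[k] U) * ψ.lTensor U (↑R⁻¹ : U ⊗[k] U) := by
  rw [← mulLastTwo_comul_lTensor, hR.comul_right_inv, mulLastTwo_leg12_mul_leg13]

end Conv

lemma rTensor_convOne :
    (1 : WithConv (U →ₗ[k] U)).ofConv.rTensor U (R : U ⊗[k] U) = 1 := by
  have h := hR.rTensor_convMul (1 : WithConv (U →ₗ[k] U)).ofConv .id
  rw [toConv_ofConv, one_mul, rTensor_id, id_apply] at h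
  exact R.mul_left_inj.mp (h.symm.trans (one_mul _).symm)

lemma lTensor_inv_convOne :
    (1 : WithConv (U →ₗ[k] U)).ofConv.lTensor U (↑R⁻¹ : U ⊗[k] U) = 1 := by
  have h := hR.lTensor_inv_convMul (1 : WithConv (U →ₗ[k] U)).ofConv .id
  rw [toConv_ofConv, one_mul, lTensor_id, id_apply] at h
  exact R⁻¹.mul_left_inj.mp (h.symm.trans (one_mul _).symm)

lemma antipode_rTensor : (antipode k).rTensor U (R : U ⊗[k] U) = ↑R⁻¹ := by
  have h := hR.rTensor_convMul (antipode k) .id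
  rw [antipode_mul_id, hR.rTensor_convOne, rTensor_id, id_apply] at h
  exact (Units.inv_eq_of_mul_eq_one_left h.symm).symm

lemma antipode_lTensor_inv : (antipode k).lTensor U (↑R⁻¹ : U ⊗[k] U) = R := by
  have h := hR.lTensor_inv_convMul (antipode k) .id
  rw [antipode_mul_id, hR.lTensor_inv_convOne, lTensor_id, id_apply] at h
  simpa only [inv_inv] using (Units.inv_eq_of_mul_eq_one_left h.symm).symm

lemma map_antipode_antipode :
    TensorProduct.map (antipode k) (antipode k) (R : U ⊗[k] U) = R := by
  rw [← lTensor_comp_rTensor, comp_apply, hR.antipode_rTensor, hR.antipode_lTensor_inv]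

lemma antipode_antipode_mul_drinfeldElement (x : U) :
    antipode k (antipode k x) * drinfeldElement (R : U ⊗[k] U) =
      drinfeldElement (R : U ⊗[k] U) * x := by
  let r := ℛ k x
  symm
  calc drinfeldElement (R : U ⊗[k] U) * x
      = drinfeldMap ((R : U ⊗[k] U) * (x ⊗ₜ 1)) := by
        rw [drinfeldMap_mul_tmul, antipode_one, one_mul, drinfeldMap_apply]
    _ = ∑ i ∈ r.index, drinfeldMap
          (TensorProduct.comm k U U (comul (r.left i)) * (R : U ⊗[k] U) *
            (1 ⊗ₜ antipode k (r.right i))) := by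
        simp only [← sum_comul_mul_one_tmul_antipode r, Finset.mul_sum, map_sum,
          hR.comm_comul_mul, mul_assoc]
    _ = antipode k (antipode k (∑ i ∈ r.index, counit (R := k) (r.left i) • r.right i)) *
          drinfeldElement (R : U ⊗[k] U) := by
        simp only [← drinfeldMap_apply, drinfeldMap_mul_tmul, drinfeldMap_comm_comul_mul, mul_one,
          map_sum, map_smul, Finset.sum_mul, smul_mul_assoc, mul_smul_comm]
    _ = antipode k (antipode k x) * drinfeldElement (R : U ⊗[k] U) := by rw [sum_counit_smul]

lemma sandwich_drinfeldElement : sandwich (drinfeldElement (R : U ⊗[k] U)) (R : U ⊗[k] U) = 1 := by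
  nth_rw 2 [← hR.antipode_lTensor_inv]
  rw [← drinfeldMap_apply, ← drinfeldMap_mul, Units.mul_inv, Algebra.TensorProduct.one_def,
    drinfeldMap_tmul, antipode_one, mul_one]

lemma isUnit_drinfeldElement : IsUnit (drinfeldElement (R : U ⊗[k] U)) := by
  set u := drinfeldElement (R : U ⊗[k] U)
  -- The inverse of `u` is `R⁽²⁾ S²(R⁽¹⁾)`.
  let v : U ⊗[k] U →ₗ[k] U := sandwich 1 ∘ₗ (antipode k ∘ₗ antipode k).rTensor U
  have h_mul_u (X : U ⊗[k] U) : v X * u = sandwich u X := by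
    induction X with
    | zero => simp only [map_zero, zero_mul]
    | add X Y hX hY => simp only [map_add, add_mul, hX, hY]
    | tmul a b => simp [v, u, mul_assoc, hR.antipode_antipode_mul_drinfeldElement]
  have h_u_mul (X : U ⊗[k] U) : u * v X =
      sandwich u (TensorProduct.map (antipode k) (antipode k)
        (TensorProduct.map (antipode k) (antipode k) X)) := by
    induction X with
    | zero => simp only [map_zero, mul_zero]
    | add X Y hX hY => simp only [map_add, mul_add, hX, hY]
    | tmul a b => simp [v, u, ← mul_assoc, hR.antipode_antipode_mul_drinfeldElement]
  refine isUnit_iff_exists.mpr ⟨v R, ?_, ?_⟩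
  · rw [h_u_mul, hR.map_antipode_antipode, hR.map_antipode_antipode, hR.sandwich_drinfeldElement]
  · rw [h_mul_u, hR.sandwich_drinfeldElement]

lemma antipode_drinfeldElement {I : U →ₗ[k] k} {t : U} (hI : IsLeftIntegral I)
    (hI' : IsRightIntegral I) (ht : IsLeftIntegralElem k t) (ht' : IsRightIntegralElem k t)
    (hIt : I t ≠ 0) :
    antipode k (drinfeldElement (R : U ⊗[k] U)) = drinfeldElement (R : U ⊗[k] U) := by
  have h_comm : TensorProduct.comm k U U
      (comul t * TensorProduct.comm k U U (R : U ⊗[k] U)) = (R : U ⊗[k] U) * comul t := by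
    rw [← hR.comm_comul_mul]
    exact (map_mul (Algebra.TensorProduct.comm k U U) _ _).trans
      (congrArg (_ * ·) (TensorProduct.comm_comm k U U _))
  have h := congrArg (sliceRight I) h_comm
  rw [sliceRight_comm, ht'.sliceLeft_comul_mul_comm, ht.sliceRight_mul_comul, hI t,
    hI'.sliceLeft_comul, smul_one_mul, mul_smul_one] at h
  rw [← drinfeldMap_apply, antipode_drinfeldMap, hR.map_antipode_antipode]
  exact (smul_right_injective _ hIt h).symm

end IsUniversalRMatrix

end RMatrix

section Trace

variable {k U : Type*} [Field k] [Ring U] [HopfAlgebra k U]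

variable (k U) in
/-- The functional `x ↦ Tr(z ↦ x S⁻²(z))` on `U`, which will represent an integral in the dual. -/
def traceFunctional : U →ₗ[k] k :=
  trace k U ∘ₗ mulRight k (antipodeInv k U ^ 2) ∘ₗ LinearMap.mul k U

lemma traceFunctional_apply (x : U) :
    traceFunctional k U x = trace k U (mulLeft k x * antipodeInv k U ^ 2) := rfl

lemma IsRightIntegralElem.traceFunctional_eq_counit [FiniteDimensional k U] {y : U}
    (hy : IsRightIntegralElem k y) (hS : IsUnit (antipode k : Module.End k U)) :
    traceFunctional k U y = counit (R := k) y := by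
  have h_counit (x : U) : counit (R := k) (antipodeInv k U x) = counit (R := k) x := by
    rw [← counit_antipode (R := k) (antipodeInv k U x)]
    exact congr(counit ($(Ring.mul_inverse_cancel _ hS) x))
  have h_rank_one : mulLeft k y * antipodeInv k U ^ 2 = (counit (R := k)).smulRight y := by
    ext x
    simp [pow_two, hy _, h_counit]
  rw [traceFunctional_apply, h_rank_one, trace_smulRight]

end Trace

namespace DualPairing

variable {k U A : Type*} [Field k] [Ring U] [HopfAlgebra k U] [Ring A] [HopfAlgebra k A]

/-- The same duality with the two Hopf algebras exchanged. -/
def flip (p : DualPairing k U A) : DualPairing k A U where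
  pair := p.pair.flip
  mul_left x y a := p.mul_right a x y
  one_left x := p.one_right x
  mul_right x a b := p.mul_left a b x
  one_right a := p.one_left a
  nondegenerate := ⟨p.nondegenerate.2, p.nondegenerate.1⟩

variable (p : DualPairing k U A)

@[simp] lemma flip_pair_apply (a : A) (x : U) : p.flip.pair a x = p.pair x a := rfl

lemma ext_left {x y : U} (h : ∀ a, p.pair x a = p.pair y a) : x = y :=
  sub_eq_zero.mp (p.nondegenerate.1 _ fun a => by rw [map_sub, LinearMap.sub_apply, h, sub_self])

lemma ext_right {a b : A} (h : ∀ x, p.pair x a = p.pair x b) : a = b := p.flip.ext_left h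

lemma pair_mul_left {κ : Type*} (x y : U) {a : A} (r : Repr k a κ) :
    p.pair (x * y) a = ∑ i ∈ r.index, p.pair x (r.left i) * p.pair y (r.right i) := by
  simp [p.mul_left, ← r.eq]

lemma pair_mul_right {κ : Type*} {x : U} (r : Repr k x κ) (a b : A) :
    p.pair x (a * b) = ∑ i ∈ r.index, p.pair (r.left i) a * p.pair (r.right i) b :=
  p.flip.pair_mul_left a b r

lemma pair_sliceLeft_comul (x y : U) (a : A) :
    p.pair x (sliceLeft (p.pair y) (comul a)) = p.pair (y * x) a := by
  rw [p.pair_mul_left _ _ (ℛ k a), ← (ℛ k a).eq]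
  simp

lemma pair_sliceRight_comul (x y : U) (a : A) :
    p.pair x (sliceRight (p.pair y) (comul a)) = p.pair (x * y) a := by
  rw [p.pair_mul_left _ _ (ℛ k a), ← (ℛ k a).eq]
  simp [mul_comm]

lemma pair_antipode (x : U) (a : A) : p.pair (antipode k x) a = p.pair x (antipode k a) := by
  -- Both sides are the convolution inverse of the pairing in the dual of `U ⊗ A`.
  let P : WithConv (U ⊗[k] A →ₗ[k] k) := toConv (TensorProduct.lift p.pair)
  have h_left : toConv (TensorProduct.lift (p.pair ∘ₗ antipode k)) * P = 1 := by
    apply WithConv.ofConv_injective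
    ext x a
    have h := congr(p.pair $(sum_antipode_mul_eq_smul (ℛ k x)) a)
    simp only [map_sum, LinearMap.sum_apply, p.pair_mul_left _ _ (ℛ k a), map_smul,
      LinearMap.smul_apply, p.one_left] at h
    simpa [((ℛ k x).tmul (ℛ k a)).convMul_apply, P, Finset.sum_product, mul_comm] using h
  have h_right : P * toConv (TensorProduct.lift (p.pair.compl₂ (antipode k))) = 1 := by
    apply WithConv.ofConv_injective
    ext x a
    have h := congr(p.pair x $(sum_mul_antipode_eq_smul (ℛ k a)))
    simp only [map_sum, p.pair_mul_right (ℛ k x), map_smul, p.one_right] at h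
    rw [Finset.sum_comm] at h
    simpa [((ℛ k x).tmul (ℛ k a)).convMul_apply, P, Finset.sum_product, mul_comm] using h
  exact congr($(left_inv_eq_right_inv h_left h_right) (x ⊗ₜ a))

lemma rightAct_one (a : A) : p.rightAct a 1 = a :=
  p.ext_right fun x => (p.pair_sliceLeft_comul x 1 a).trans (by rw [one_mul])

section LeftAct

lemma pair_sliceRight_flip_comul (a b : A) (x : U) :
    p.pair (sliceRight (p.flip.pair a) (comul x)) b = p.pair x (b * a) :=
  p.flip.pair_sliceRight_comul b a x

/-- The left action `a ▷ x = x₍₁₎ ⟨x₍₂₎, a⟩` of `A` on its dual `U`. -/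
def leftAct : A →ₐ[k] Module.End k U :=
  AlgHom.ofLinearMap
    ((TensorProduct.rid k U).toLinearMap.compRight k ∘ₗ lcomp k _ comul ∘ₗ lTensorHom U ∘ₗ
      p.flip.pair)
    (LinearMap.ext fun x => p.ext_left fun c =>
      (p.pair_sliceRight_flip_comul 1 c x).trans (by rw [mul_one, Module.End.one_apply]))
    fun a b => LinearMap.ext fun x => p.ext_left fun c =>
      calc p.pair (sliceRight (p.flip.pair (a * b)) (comul x)) c
          = p.pair (sliceRight (p.flip.pair b) (comul x)) (c * a) := by
            simp only [pair_sliceRight_flip_comul, mul_assoc]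
        _ = p.pair (sliceRight (p.flip.pair a) (comul (sliceRight (p.flip.pair b) (comul x)))) c :=
            (p.pair_sliceRight_flip_comul _ _ _).symm

lemma pair_leftAct (a b : A) (x : U) : p.pair (p.leftAct a x) b = p.pair x (b * a) :=
  p.pair_sliceRight_flip_comul a b x

lemma leftAct_mul_apply {κ : Type*} {a : A} (r : Repr k a κ) (x y : U) :
    p.leftAct a (x * y) = ∑ i ∈ r.index, p.leftAct (r.left i) x * p.leftAct (r.right i) y := by
  refine p.ext_left fun b => ?_
  simp only [map_sum, LinearMap.sum_apply, p.pair_mul_left _ _ (ℛ k b), pair_leftAct,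
    p.pair_mul_left _ _ ((ℛ k b).mul r), Repr.mul_index, Repr.mul_left, Repr.mul_right,
    Finset.sum_product]
  exact Finset.sum_comm

lemma mulLeft_leftAct {κ : Type*} {a : A} (r : Repr k a κ) (x : U) :
    mulLeft k (p.leftAct a x) = ∑ i ∈ r.index,
      p.leftAct (r.left i) * mulLeft k x * p.leftAct (antipode k (r.right i)) := by
  let L : WithConv (A →ₗ[k] Module.End k U) :=
    toConv (LinearMap.mul k U ∘ₗ p.leftAct.toLinearMap.flip x)
  let L' : WithConv (A →ₗ[k] Module.End k U) :=
    toConv (mulRight k (mulLeft k x) ∘ₗ p.leftAct.toLinearMap)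
  have h_mul : L * toConv p.leftAct.toLinearMap = L' := by
    ext a y
    rw [(ℛ k a).convMul_apply]
    simp [L, L', p.leftAct_mul_apply (ℛ k a)]
  have h : L = L' * toConv (p.leftAct.toLinearMap ∘ₗ antipode k) := by
    rw [← h_mul, mul_assoc, algHom_convMul_comp_antipode, mul_one]
  exact congr($h a).trans (r.convMul_apply _ _)

lemma antipode_sq_mul_leftAct (a : A) :
    (antipode k : Module.End k U) ^ 2 * p.leftAct (antipode k (antipode k a)) =
      p.leftAct a * (antipode k : Module.End k U) ^ 2 := by
  ext x
  refine p.ext_left fun b => ?_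
  simp [pow_two, pair_antipode, pair_leftAct, antipode_mul_antidistrib]

lemma antipodeInv_sq_mul_leftAct (hS : IsUnit (antipode k : Module.End k U)) (a : A) :
    antipodeInv k U ^ 2 * p.leftAct a =
      p.leftAct (antipode k (antipode k a)) * antipodeInv k U ^ 2 := by
  rw [antipodeInv, Ring.inverse_pow]
  set T := (antipode k : Module.End k U) ^ 2
  have hT : IsUnit T := hS.pow 2
  calc Ring.inverse T * p.leftAct a
      = Ring.inverse T * (p.leftAct a * T) * Ring.inverse T := by
        rw [mul_assoc, mul_assoc, Ring.mul_inverse_cancel _ hT, mul_one]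
    _ = p.leftAct (antipode k (antipode k a)) * Ring.inverse T := by
        rw [← p.antipode_sq_mul_leftAct, ← mul_assoc, Ring.inverse_mul_cancel _ hT, one_mul]

lemma traceFunctional_leftAct (hS : IsUnit (antipode k : Module.End k U)) (a : A) (x : U) :
    traceFunctional k U (p.leftAct a x) = counit (R := k) a * traceFunctional k U x := by
  let r := ℛ k a
  set T := antipodeInv k U ^ 2
  have h_cycle (b c : A) : trace k U (p.leftAct b * mulLeft k x * p.leftAct (antipode k c) * T) =
      trace k U (mulLeft k x * p.leftAct (antipode k (antipode k b * c)) * T) := by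
    rw [mul_assoc, mul_assoc, trace_mul_comm, mul_assoc, mul_assoc, mul_assoc,
      p.antipodeInv_sq_mul_leftAct hS, antipode_mul_antidistrib, map_mul p.leftAct, mul_assoc]
  calc traceFunctional k U (p.leftAct a x)
      = ∑ i ∈ r.index, trace k U (mulLeft k x *
          p.leftAct (antipode k (antipode k (r.left i) * r.right i)) * T) := by
        rw [traceFunctional_apply, p.mulLeft_leftAct r, Finset.sum_mul, map_sum]
        exact Finset.sum_congr rfl fun i _ => h_cycle _ _
    _ = trace k U (mulLeft k x * p.leftAct (antipode k (counit (R := k) a • 1)) * T) := by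
        rw [← sum_antipode_mul_eq_smul r]
        simp only [map_sum, Finset.sum_mul, Finset.mul_sum]
    _ = counit (R := k) a * traceFunctional k U x := by
        simp [traceFunctional_apply, T]

lemma isRightIntegralElem_of_pair_eq_traceFunctional
    (hS : IsUnit (antipode k : Module.End k U)) {t : A}
    (ht : ∀ x, p.pair x t = traceFunctional k U x) : IsRightIntegralElem k t := fun a =>
  p.ext_right fun x => by
    rw [← p.pair_leftAct, ht, p.traceFunctional_leftAct hS, map_smul, ht, smul_eq_mul]

end LeftAct

lemma exists_pair_eq [FiniteDimensional k U] (φ : U →ₗ[k] k) : ∃ a, ∀ x, p.pair x a = φ x := by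
  have h_left : Function.Injective p.pair := fun x y h => p.ext_left fun a => congr($h a)
  have h_right : Function.Injective p.pair.flip := fun a b h => p.ext_right fun x => congr($h x)
  obtain ⟨a, ha⟩ := (IsPerfPair.of_injective h_left h_right).bijective_right.2 φ
  exact ⟨a, fun x => congr($ha x)⟩

section Transfer

variable {y : U}

lemma isRightIntegral_pair (hy : IsRightIntegralElem k y) : IsRightIntegral (p.pair y) := fun a =>
  p.ext_right fun x => by
    refine (p.pair_sliceLeft_comul x y a).trans ?_
    rw [hy, map_smul, map_smul, p.one_right, LinearMap.smul_apply, smul_eq_mul, smul_eq_mul,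
      mul_comm]

lemma isLeftIntegral_pair (hy : IsLeftIntegralElem k y) : IsLeftIntegral (p.pair y) := fun a =>
  p.ext_right fun x => by
    rw [p.pair_sliceRight_comul, hy, map_smul, map_smul, p.one_right, LinearMap.smul_apply,
      smul_eq_mul, smul_eq_mul, mul_comm]

end Transfer

include p in
lemma isUnit_antipode_right [FiniteDimensional k A] (hU : IsUnit (antipode k : Module.End k U)) :
    IsUnit (antipode k : Module.End k A) := by
  refine (LinearMap.isUnit_iff_ker_eq_bot _).mpr (LinearMap.ker_eq_bot'.mpr fun a ha => ?_)
  refine p.ext_right fun x => ?_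
  obtain ⟨x, rfl⟩ := ((Module.End.isUnit_iff _).mp hU).2 x
  rw [p.pair_antipode, ha, map_zero, map_zero]

lemma pair_antipodeInv (hU : IsUnit (antipode k : Module.End k U))
    (hA : IsUnit (antipode k : Module.End k A)) (x : U) (a : A) :
    p.pair (antipodeInv k U x) a = p.pair x (antipodeInv k A a) :=
  calc p.pair (antipodeInv k U x) a
      = p.pair (antipodeInv k U x) (antipode k (antipodeInv k A a)) :=
        congr(p.pair _ ($(Ring.mul_inverse_cancel _ hA) a)).symm
    _ = p.pair (antipode k (antipodeInv k U x)) (antipodeInv k A a) := (p.pair_antipode _ _).symm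
    _ = p.pair x (antipodeInv k A a) := congr(p.pair ($(Ring.mul_inverse_cancel _ hU) x) _)

section DualBases

variable {ι : Type*} {e : Module.Basis ι k U} {f : Module.Basis ι k A}

variable {p} in
lemma IsDualBases.flip (h : p.IsDualBases e f) : p.flip.IsDualBases f e :=
  ⟨h.1, fun i j hij => h.2 j i hij.symm⟩

variable {p} in
lemma IsDualBases.coord_apply (h : p.IsDualBases e f) (x : U) (i : ι) :
    e.coord i x = p.pair x (f i) := by
  refine congr($(e.ext (f₁ := e.coord i) (f₂ := p.flip.pair (f i)) fun j => ?_) x)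
  obtain rfl | hij := eq_or_ne j i
  · simp [h.1]
  · simp [h.2 j i hij, hij]

variable {p} in
lemma IsDualBases.trace_eq_sum [Fintype ι] (h : p.IsDualBases e f) (T : Module.End k U) :
    trace k U T = ∑ i, p.pair (T (e i)) (f i) := by
  classical
  simp [trace_eq_matrix_trace k e, Matrix.trace, toMatrix_apply, ← h.coord_apply]

variable [Fintype ι]

lemma isUnit_antipode_of_sigma'_ne_zero (hσ' : p.sigma' e f ≠ 0) :
    IsUnit (antipode k : Module.End k U) := by
  -- `Ring.inverse` is zero off the units.
  contrapose! hσ'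
  simp [sigma', antipodeInv, Ring.inverse_non_unit _ hσ']

lemma sigma'_flip (hU : IsUnit (antipode k : Module.End k U))
    (hA : IsUnit (antipode k : Module.End k A)) : p.flip.sigma' f e = p.sigma' e f := by
  simp [sigma', pow_two, p.pair_antipodeInv hU hA]

variable {p} in
lemma IsDualBases.traceFunctional_one (h : p.IsDualBases e f) :
    traceFunctional k U 1 = p.sigma' e f := by
  rw [traceFunctional_apply, mulLeft_one, ← Module.End.one_eq_id, one_mul, h.trace_eq_sum]
  rfl

namespace IsDualBases

variable {p}
variable (h : p.IsDualBases e f) (hσ' : p.sigma' e f ≠ 0)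
  (hU : IsUnit (antipode k : Module.End k U)) (hA : IsUnit (antipode k : Module.End k A))
include h hσ' hU hA

lemma exists_isSemisimpleIntegral_pair_eq_traceFunctional [FiniteDimensional k U] :
    ∃ t, IsSemisimpleIntegral k t ∧ ∀ x, p.pair x t = traceFunctional k U x := by
  obtain ⟨t, ht⟩ := p.exists_pair_eq (traceFunctional k U)
  have h_counit : counit (R := k) t ≠ 0 := by rwa [← p.one_left, ht, h.traceFunctional_one]
  exact ⟨t, (p.isRightIntegralElem_of_pair_eq_traceFunctional hU ht).isSemisimpleIntegral h_counit
    ((Module.End.isUnit_iff _).mp hA).2, ht⟩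

lemma exists_isSemisimpleIntegral_pair_ne_zero [FiniteDimensional k U] [FiniteDimensional k A] :
    ∃ y t, IsSemisimpleIntegral k y ∧ IsSemisimpleIntegral k t ∧ p.pair y t ≠ 0 := by
  obtain ⟨t, ht, htr⟩ := h.exists_isSemisimpleIntegral_pair_eq_traceFunctional hσ' hU hA
  obtain ⟨y, hy, -⟩ := h.flip.exists_isSemisimpleIntegral_pair_eq_traceFunctional
    (by rwa [p.sigma'_flip hU hA]) hA hU
  refine ⟨y, t, hy, ht, ?_⟩
  rw [htr, hy.right.traceFunctional_eq_counit hU]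
  exact hy.counit_ne_zero

end IsDualBases

end DualBases

section SemisimpleIntegral

variable {y : U} {t : A} (hy : IsSemisimpleIntegral k y) (ht : IsSemisimpleIntegral k t)
  (hyt : p.pair y t ≠ 0)
include hy ht hyt

lemma antipode_pow_four_eq_one_right (hA : IsUnit (antipode k : Module.End k A)) :
    (antipode k : Module.End k A) ^ 4 = 1 :=
  antipode_pow_four_eq_one (p.isLeftIntegral_pair hy.left) (p.isRightIntegral_pair hy.right)
    (fun a => by rw [← p.pair_antipode, hy.antipode_eq_self]) ht.left ht.right hyt
    ((Module.End.isUnit_iff _).mp hA).1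

lemma apply_mul_eq_apply_antipode_sq_mul_of_isRightIntegral {I : A →ₗ[k] k}
    (hI : IsRightIntegral I) (a b : A) : I (b * a) = I (antipode k (antipode k a) * b) := by
  have h_swap := apply_mul_eq_apply_antipode_sq_mul (p.isLeftIntegral_pair hy.left)
    (p.isRightIntegral_pair hy.right) (fun a => by rw [← p.pair_antipode, hy.antipode_eq_self])
    ht.left ht.right hyt a b
  have h_prop := hI.apply_mul_apply_one (p.isLeftIntegral_pair hy.left)
  have h_one : p.pair y 1 ≠ 0 := by rw [p.one_right]; exact hy.counit_ne_zero
  refine mul_right_cancel₀ h_one ?_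
  rw [h_prop, h_prop, h_swap]

end SemisimpleIntegral

end DualPairing

end

end QuantumIntegration

theorem mainTheorem4_general
    {k U A : Type*} [Field k] [Ring U] [HopfAlgebra k U] [Ring A] [HopfAlgebra k A]
    (p : QuantumIntegration.DualPairing k U A)
    {ι : Type*} [Fintype ι] (e : Module.Basis ι k U) (f : Module.Basis ι k A)
    (hef : p.IsDualBases e f)
    (hσ' : p.sigma' e f ≠ 0) :
    (∀ R : (TensorProduct k U U)ˣ, QuantumIntegration.IsUniversalRMatrix R →
      ∃ u s : Uˣ,
        (u : U) = QuantumIntegration.drinfeldElement (R : TensorProduct k U U) ∧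
        (s : U) = (u : U) * HopfAlgebra.antipode k (u : U) * ((u⁻¹ : Uˣ) : U) ^ 2 ∧
        (∀ a : A, ((HopfAlgebra.antipode k : Module.End k A) ^ 4) a
          = p.rightAct a ((s⁻¹ : Uˣ) : U)) ∧
        (∀ x : U, ((HopfAlgebra.antipode k : Module.End k U) ^ 4) x = ((s⁻¹ : Uˣ) : U) * x)) ∧
    (∀ x : U, ((HopfAlgebra.antipode k : Module.End k U) ^ 4) x = x) ∧
    (∀ a : A, ((HopfAlgebra.antipode k : Module.End k A) ^ 4) a = a) ∧
    (∀ I : A →ₗ[k] k, QuantumIntegration.IsRightIntegral I →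
      ∀ a b : A, I (b * a) = I (((HopfAlgebra.antipode k : Module.End k A) ^ 2) a * b)) := by
  have : FiniteDimensional k U := .of_basis e
  have : FiniteDimensional k A := .of_basis f
  have hU := p.isUnit_antipode_of_sigma'_ne_zero hσ'
  have hA := p.isUnit_antipode_right hU
  obtain ⟨y, t, hy, ht, hyt⟩ := hef.exists_isSemisimpleIntegral_pair_ne_zero hσ' hU hA
  have hS_A := p.antipode_pow_four_eq_one_right hy ht hyt hA
  have hS_U := p.flip.antipode_pow_four_eq_one_right ht hy hyt hU
  refine ⟨fun R hR => ?_, fun x => congr($hS_U x), fun a => congr($hS_A a), fun I hI a b =>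
    p.apply_mul_eq_apply_antipode_sq_mul_of_isRightIntegral hy ht hyt hI a b⟩
  obtain ⟨u, hu⟩ := hR.isUnit_drinfeldElement
  have hSu : HopfAlgebra.antipode k (u : U) = u := by
    rw [hu]
    exact hR.antipode_drinfeldElement (p.flip.isLeftIntegral_pair ht.left)
      (p.flip.isRightIntegral_pair ht.right) hy.left hy.right hyt
  refine ⟨u, 1, hu, by simp [hSu, pow_two, mul_assoc], fun a => ?_, fun x => ?_⟩
  · rw [hS_A, inv_one, Units.val_one, p.rightAct_one, Module.End.one_apply]
  · rw [hS_U, inv_one, Units.val_one, one_mul, Module.End.one_apply]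

theorem mainTheorem4
    {k U A : Type*} [Field k]
    [Ring U] [HopfAlgebra k U] [FiniteDimensional k U]
    [Ring A] [HopfAlgebra k A] [FiniteDimensional k A]
    (p : QuantumIntegration.DualPairing k U A)
    {ι : Type*} [Fintype ι] (e : Module.Basis ι k U) (f : Module.Basis ι k A)
    (hef : p.IsDualBases e f)
    (hσ' : p.sigma' e f ≠ 0)
    (R : (TensorProduct k U U)ˣ) (hR : QuantumIntegration.IsUniversalRMatrix R) :
    (∃ u s : Uˣ,
      (u : U) = QuantumIntegration.drinfeldElement (R : TensorProduct k U U) ∧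
      (s : U) = (u : U) * HopfAlgebra.antipode k (u : U) * ((u⁻¹ : Uˣ) : U) ^ 2 ∧
      (∀ a : A, ((HopfAlgebra.antipode k : Module.End k A) ^ 4) a
        = p.rightAct a ((s⁻¹ : Uˣ) : U)) ∧
      (∀ x : U, ((HopfAlgebra.antipode k : Module.End k U) ^ 4) x = ((s⁻¹ : Uˣ) : U) * x)) ∧
    (∀ x : U, ((HopfAlgebra.antipode k : Module.End k U) ^ 4) x = x) ∧
    (∀ a : A, ((HopfAlgebra.antipode k : Module.End k A) ^ 4) a = a) ∧
    (∀ I : A →ₗ[k] k, QuantumIntegration.IsRightIntegral I →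
      ∀ a b : A, I (b * a) = I (((HopfAlgebra.antipode k : Module.End k A) ^ 2) a * b)) := by
  obtain ⟨h_drinfeld, h⟩ := mainTheorem4_general p e f hef hσ'
  exact ⟨h_drinfeld R hR, h⟩
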